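/- Let $q$ be a prime power. A Reed--Solomon code over $GF(q)$ is a cyclic code of length $q-1$ with generator polynomial $\prod_{i=0}^{m-1}(X-\alpha^{b+i})$, where $\alpha$ is a primitive element of $GF(q)$, $b\ge 0$ and $0\le m\le q-1$. As usual, $[n,k,d]_q$ denotes a linear code over $GF(q)$ of length $n$, dimension $k$ and minimum distance $d$ (for the zero code the condition on the distance is void). An $[[n,k,d]]_q$ quantum error-correcting code, $k\ge 1$, is a subspace $\mathcal C$ of $(\mathbb C^q)^{\otimes n}$ of dimension $q^k$ whose minimum distance is $d$: every linear operator $E$ that acts non-trivially on fewer than $d$ of the tensor factors only is detected, i.e. $PEP=zP$ for some $z\in\mathbb C$, where $P$ is the orthogonal projection onto $\mathcal C$, and some operator that acts non-trivially on at most $d$ tensor factors is not detected. Theorem. Let $C_1=[q-1,\mu_1,q-\mu_1]_q$ and $C_2=[q-1,\mu_2,q-\mu_2]_q$ be Reed--Solomon codes with $\mu_1<(q-1)/2$. Then $2\mu_1\mu_2<(q-1)^2$, and there exists a quantum error-correcting code with parameters $$[[\,(q-1)^2,\ (q-1)^2-2\mu_1\mu_2,\ 1+\min(\mu_1,\mu_2)\,]]_q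 .$$ -/

import Mathlib

/-! ### Classical linear codes -/

/-- `C` is a linear code `[n, k, d]` over `F` (with `n` the length of the ambient space): its
dimension is `k` and its minimum distance is `d`, that is, every nonzero codeword has Hamming
weight at least `d` and, if there are nonzero codewords at all, weight `d` occurs. -/
def HasCodeParameters {F : Type*} [Field F] [DecidableEq F] {n : ℕ}
    (C : Submodule F (Fin n → F)) (k d : ℕ) : Prop :=
  Module.finrank F C = k ∧
    (∀ c ∈ C, c ≠ 0 → d ≤ hammingNorm c) ∧
    (C ≠ ⊥ → ∃ c ∈ C, c ≠ 0 ∧ hammingNorm c = d)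

/-- The polynomial `c₀ + c₁ X + ⋯ + cₙ₋₁ Xⁿ⁻¹` of a word `c`. -/
noncomputable def wordPolynomial {F : Type*} [Field F] {n : ℕ} (c : Fin n → F) : Polynomial F :=
  ∑ i : Fin n, Polynomial.C (c i) * Polynomial.X ^ (i : ℕ)

/-- The code of all words of length `n` whose polynomial is a multiple of `g`. If `g` divides
`Xⁿ - 1`, this is the cyclic code of length `n` with generator polynomial `g`. -/
noncomputable def cyclicCode {F : Type*} [Field F] (n : ℕ) (g : Polynomial F) :
    Submodule F (Fin n → F) where
  carrier := {c | g ∣ wordPolynomial c}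
  zero_mem' := by simp [wordPolynomial]
  add_mem' := by
    intro a b ha hb
    have h : wordPolynomial (a + b) = wordPolynomial a + wordPolynomial b := by
      simp [wordPolynomial, add_mul, Finset.sum_add_distrib]
    simpa [h] using dvd_add ha hb
  smul_mem' := by
    intro r a ha
    have h : wordPolynomial (r • a) = Polynomial.C r * wordPolynomial a := by
      simp [wordPolynomial, Finset.mul_sum, mul_assoc]
    simpa [h] using Dvd.dvd.mul_left ha (Polynomial.C r)

/-- `C` is a Reed-Solomon code of length `q - 1` (over a field with `q` elements): a cyclic code
whose generator polynomial is `∏_{i < m} (X - α ^ (b + i))`, with `α` a primitive root of unity of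
order `q - 1`, `m ≤ q - 1` consecutive zeros (so designed distance `m + 1`), the first of them
being `α ^ b`. -/
def IsReedSolomon {F : Type*} [Field F] (q : ℕ) (C : Submodule F (Fin (q - 1) → F)) : Prop :=
  ∃ α : F, IsPrimitiveRoot α (q - 1) ∧ ∃ b m : ℕ, m ≤ q - 1 ∧
    C = cyclicCode (q - 1)
      (∏ i ∈ Finset.range m, (Polynomial.X - Polynomial.C (α ^ (b + i))))

/-! ### Quantum codes

The state space of `n` qudits of dimension `q` is `(ℂ^q)^{⊗ n}`, with orthonormal basis the vectors
`|x₁⟩ ⊗ ⋯ ⊗ |xₙ⟩`; it is written here as the space of functions on the set of basis labels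
`x : ι → A`, where `ι` is the set of the `n` qudits and `A` has `q` elements. -/

/-- The state space of a family of qudits indexed by `ι`, each with basis labelled by `A`. -/
abbrev QuditSpace (ι A : Type*) : Type _ := EuclideanSpace ℂ (ι → A)

/-- The operator `E`, given by its matrix in the standard basis, acts only on the qudits in `S`:
it is `T ⊗ 1`, where `T` is an operator on the qudits in `S` and `1` is the identity on all the
others. -/
def ActsOnlyOn {ι A : Type*} (S : Finset ι) (E : Matrix (ι → A) (ι → A) ℂ) : Prop :=
  ∃ T : Matrix (S → A) (S → A) ℂ,
    (∀ x y : ι → A, (∀ i, i ∉ S → x i = y i) → E x y = T (fun i => x i) (fun i => y i)) ∧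
    (∀ x y : ι → A, (¬ ∀ i, i ∉ S → x i = y i) → E x y = 0)

/-- The quantum code `Q` detects the error `E`: there is a scalar `z` with `P E P = z P` for the
orthogonal projection `P` onto `Q`, written through matrix elements between code states. -/
def DetectsError {ι A : Type*} [Fintype ι] [DecidableEq ι] [Fintype A] [DecidableEq A]
    (Q : Submodule ℂ (QuditSpace ι A)) (E : Matrix (ι → A) (ι → A) ℂ) : Prop :=
  ∃ z : ℂ, ∀ u ∈ Q, ∀ v ∈ Q, inner ℂ u (Matrix.toEuclideanLin E v) = z * inner ℂ u v

/-- `Q` is a quantum error-correcting code `[[n, k, d]]_q`: a subspace of the state space of `n`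
qudits of dimension `q` that has dimension `q ^ k` (it encodes `k` qudits) and minimum distance
exactly `d`, the least number of qudits on which an undetectable error can act. (For `k = 0`
every error is detected and this is never satisfied; only `k > 0` is of interest.) -/
structure IsQuantumCode (n k d q : ℕ) (Q : Submodule ℂ (QuditSpace (Fin n) (Fin q))) : Prop where
  finrank_eq : Module.finrank ℂ Q = q ^ k
  minDist : IsLeast {w : ℕ | ∃ S : Finset (Fin n), S.card = w ∧
    ∃ E : Matrix (Fin n → Fin q) (Fin n → Fin q) ℂ, ActsOnlyOn S E ∧ ¬ DetectsError Q E} d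

/-! A self-orthogonal code `C` gives a CSS code: the states supported on `D = dualCode C` and
constant on cosets of `C`. Between such states an operator on few coordinates has only diagonal
matrix elements, since `D` has no light words, and averaging over `C` makes these scalar
(`cssCode_detectsError`). Translation by a lightest word of `D` outside `C` is not detected
(`cssCode_not_detectsError`). The code `C` is built directly from μ₁ and μ₂: the values on Fˣ × Fˣ
of the polynomials x f(x, y), of bounded degree in each variable. The factor x makes it
self-orthogonal, as the x-exponents in products run from 2 to 2μ₁ < q - 1 and those power sums over
Fˣ vanish. Interpolation bounds the dual distance below by 1 + min(μ₁, μ₂), and a dimension count on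
one line attains it. Nonzero words of `C` are heavier than that, so a lightest dual word lies
outside `C`. -/

section DualCode

/-! ### Euclidean duals of linear codes -/

variable {F ι : Type*} [Field F] [Fintype ι] [DecidableEq ι]

/-- The Euclidean dual of a linear code. -/
def dualCode (C : Submodule F (ι → F)) : Submodule F (ι → F) :=
  (C.map (dotProductEquiv F ι).toLinearMap).dualCoannihilator

theorem mem_dualCode {C : Submodule F (ι → F)} {x : ι → F} :
    x ∈ dualCode C ↔ ∀ c ∈ C, c ⬝ᵥ x = 0 := by
  simp only [dualCode, Submodule.mem_dualCoannihilator, Submodule.mem_map,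
    LinearEquiv.coe_coe, forall_exists_index, and_imp, forall_apply_eq_imp_iff₂]
  rfl

theorem finrank_add_finrank_dualCode (C : Submodule F (ι → F)) :
    Module.finrank F C + Module.finrank F (dualCode C) = Fintype.card ι := by
  have h := Subspace.finrank_add_finrank_dualCoannihilator_eq
    (C.map (dotProductEquiv F ι).toLinearMap)
  rw [LinearEquiv.finrank_map_eq, Module.finrank_fintype_fun_eq_card] at h
  exact h

/-- A code is onto every set of coordinates smaller than the minimum distance of its dual. -/
theorem exists_mem_eq_on_of_card_lt_dual_distance [DecidableEq F] {C : Submodule F (ι → F)} {d : ℕ}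
    (hd : ∀ x ∈ dualCode C, x ≠ 0 → d ≤ hammingNorm x) {S : Finset ι} (hS : S.card < d)
    (f : ι → F) : ∃ c ∈ C, ∀ i ∈ S, c i = f i := by
  let π : (ι → F) →ₗ[F] (S → F) := LinearMap.funLeft F F Subtype.val
  suffices h : C.map π = ⊤ by
    have hf : π f ∈ C.map π := h ▸ Submodule.mem_top
    obtain ⟨c, hc, hcf⟩ := hf
    exact ⟨c, hc, fun i hi => congrFun hcf ⟨i, hi⟩⟩
  by_contra hne
  obtain ⟨φ, hφ, hle⟩ := Submodule.exists_le_ker_of_lt_top _ (lt_top_iff_ne_top.2 hne)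
  -- A functional killing the restriction of `C` to `S` is the dot product with a dual word
  -- supported on `S`, hence too light.
  let w : ι → F := (dotProductEquiv F ι).symm (φ ∘ₗ π)
  have hw : ∀ x, w ⬝ᵥ x = φ (π x) := fun x =>
    LinearMap.congr_fun ((dotProductEquiv F ι).apply_symm_apply (φ ∘ₗ π)) x
  have hwC : w ∈ dualCode C := mem_dualCode.2 fun c hc => by
    rw [dotProduct_comm, hw]
    exact hle (Submodule.mem_map_of_mem hc)
  have hw0 : w ≠ 0 := by
    intro h0
    apply hφ
    ext1 s
    ext
    obtain ⟨x, hx⟩ := LinearMap.funLeft_surjective_of_injective F F _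
      (Subtype.val_injective (p := (· ∈ S))) (Pi.single s 1)
    have := hw x
    rw [h0, zero_dotProduct] at this
    simpa [π, hx] using this.symm
  have hsupp : hammingNorm w ≤ S.card := by
    refine Finset.card_le_card fun i hi => ?_
    by_contra hiS
    refine (Finset.mem_filter.1 hi).2 ?_
    have : π (Pi.single i 1) = 0 := by
      ext s
      have : (s : ι) ≠ i := fun h => hiS (h ▸ s.2)
      simp [π, LinearMap.funLeft_apply, this]
    simpa [this] using hw (Pi.single i 1)
  have := hd w hwC hw0
  omega

end DualCode

/-! ### The CSS construction -/

section CSS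

variable {F ι A : Type*} [Field F]

/-- Translation of basis labels by a word `c`, where labels are identified with field elements. -/
def shiftLabel (ε : A ≃ F) (c : ι → F) : (ι → A) ≃ (ι → A) :=
  ((Equiv.refl ι).arrowCongr ε).trans
    ((Equiv.addRight c).trans ((Equiv.refl ι).arrowCongr ε).symm)

theorem shiftLabel_apply (ε : A ≃ F) (c : ι → F) (x : ι → A) (i : ι) :
    shiftLabel ε c x i = ε.symm (ε (x i) + c i) := rfl

theorem comp_shiftLabel (ε : A ≃ F) (c : ι → F) (x : ι → A) :
    ε ∘ shiftLabel ε c x = ε ∘ x + c := by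
  ext i
  simp [shiftLabel_apply]

open Classical in
/-- The state `∑ f (x + C) |x⟩`, the sum over `x ∈ D`, for a function `f` on `D / C`. -/
noncomputable def cosetState (ε : A ≃ F) (C D : Submodule F (ι → F)) :
    ((D ⧸ C.comap D.subtype) → ℂ) →ₗ[ℂ] QuditSpace ι A where
  toFun f := WithLp.toLp 2 fun x =>
    if h : ε ∘ x ∈ D then f (Submodule.Quotient.mk ⟨ε ∘ x, h⟩) else 0
  map_add' f g := by
    ext x
    by_cases h : ε ∘ x ∈ D <;> simp [h]
  map_smul' r f := by
    ext x
    by_cases h : ε ∘ x ∈ D <;> simp [h]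

theorem cosetState_apply_of_mem (ε : A ≃ F) (C D : Submodule F (ι → F))
    (f : (D ⧸ C.comap D.subtype) → ℂ) {x : ι → A} (h : ε ∘ x ∈ D) :
    cosetState ε C D f x = f (Submodule.Quotient.mk ⟨ε ∘ x, h⟩) := by
  simp [cosetState, h]

theorem cosetState_apply_of_notMem (ε : A ≃ F) (C D : Submodule F (ι → F))
    (f : (D ⧸ C.comap D.subtype) → ℂ) {x : ι → A} (h : ε ∘ x ∉ D) :
    cosetState ε C D f x = 0 := by
  simp [cosetState, h]

theorem cosetState_shiftLabel (ε : A ≃ F) {C D : Submodule F (ι → F)} (hCD : C ≤ D)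
    (f : (D ⧸ C.comap D.subtype) → ℂ) {c : ι → F} (hc : c ∈ C) (x : ι → A) :
    cosetState ε C D f (shiftLabel ε c x) = cosetState ε C D f x := by
  have key : ε ∘ shiftLabel ε c x ∈ D ↔ ε ∘ x ∈ D := by
    rw [comp_shiftLabel]
    exact D.add_mem_iff_left (hCD hc)
  by_cases h : ε ∘ x ∈ D
  · rw [cosetState_apply_of_mem _ _ _ _ h, cosetState_apply_of_mem _ _ _ _ (key.2 h)]
    congr 1
    rw [Submodule.Quotient.eq]
    simpa [comp_shiftLabel] using hc
  · rw [cosetState_apply_of_notMem _ _ _ _ h, cosetState_apply_of_notMem _ _ _ _ (mt key.1 h)]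

theorem cosetState_injective (ε : A ≃ F) (C D : Submodule F (ι → F)) :
    Function.Injective (cosetState ε C D) := by
  intro f g hfg
  ext y
  obtain ⟨⟨y, hy⟩, rfl⟩ := Submodule.Quotient.mk_surjective _ y
  have hx : ε ∘ (ε.symm ∘ y) = y := by ext i; simp
  have hx' : ε ∘ (ε.symm ∘ y) ∈ D := hx.symm ▸ hy
  have := congrArg (fun u : QuditSpace ι A => u (ε.symm ∘ y)) hfg
  simp only [cosetState_apply_of_mem _ _ _ _ hx'] at this
  simpa only [hx] using this

/-- The CSS code of a chain `C ≤ D`: states supported on `D` and invariant under `C`. -/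
noncomputable def cssCode (ε : A ≃ F) (C D : Submodule F (ι → F)) :
    Submodule ℂ (QuditSpace ι A) := LinearMap.range (cosetState ε C D)

theorem finrank_cssCode [Fintype F] [Fintype ι] (ε : A ≃ F) {C D : Submodule F (ι → F)} (hCD : C ≤ D) :
    Module.finrank ℂ (cssCode ε C D) =
      Fintype.card F ^ (Module.finrank F D - Module.finrank F C) := by
  classical
  have h := (C.comap D.subtype).finrank_quotient_add_finrank
  rw [(Submodule.comapSubtypeEquivOfLe hCD).finrank_eq] at h
  rw [cssCode, LinearMap.finrank_range_of_inj (cosetState_injective ε C D),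
    Module.finrank_fintype_fun_eq_card, Module.card_eq_pow_finrank (K := F)]
  congr 1
  omega

variable [Fintype ι] [Fintype A] [DecidableEq ι] [DecidableEq A]

/-- Matrix elements between states supported on `D`, of an operator acting only on a set of
coordinates which supports no nonzero word of `D`, involve diagonal entries only. -/
theorem inner_toEuclideanLin_of_local (ε : A ≃ F) {D : Submodule F (ι → F)} {S : Finset ι}
    (hS : ∀ x ∈ D, (∀ i, i ∉ S → x i = 0) → x = 0) {E : Matrix (ι → A) (ι → A) ℂ}
    (hE : ∀ x y : ι → A, (¬ ∀ i, i ∉ S → x i = y i) → E x y = 0) {u v : QuditSpace ι A}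
    (hu : ∀ x, ε ∘ x ∉ D → u x = 0) (hv : ∀ x, ε ∘ x ∉ D → v x = 0) :
    inner ℂ u (Matrix.toEuclideanLin E v) = ∑ x, E x x * inner ℂ (u x) (v x) := by
  rw [PiLp.inner_apply]
  refine Finset.sum_congr rfl fun x _ => ?_
  by_cases hx : ε ∘ x ∈ D
  · have : (Matrix.toEuclideanLin E v) x = E x x * v x := by
      rw [Matrix.ofLp_toLpLin, Matrix.toLin'_apply, Matrix.mulVec, dotProduct]
      refine Finset.sum_eq_single x (fun y _ hyx => ?_) (by simp)
      by_cases hy : ε ∘ y ∈ D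
      · rw [hE, zero_mul]
        intro hxy
        apply hyx
        have := hS _ (D.sub_mem hy hx) fun i hi => by simp [hxy i hi]
        ext i
        exact ε.injective (sub_eq_zero.1 (congrFun this i))
      · rw [hv y hy, mul_zero]
    rw [this, RCLike.inner_apply, RCLike.inner_apply, mul_assoc]
  · simp [hu x hx]

omit [DecidableEq A] in
/-- Averaging over `C` turns a local function into a constant, if `C` is onto the coordinates
concerned. -/
theorem sum_local_mul_invariant [Fintype F] (ε : A ≃ F) {C : Submodule F (ι → F)} {S : Finset ι}
    (hS : ∀ f : ι → F, ∃ c ∈ C, ∀ i ∈ S, c i = f i) (t : (S → A) → ℂ) :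
    ∃ z : ℂ, ∀ p : (ι → A) → ℂ, (∀ c ∈ C, ∀ x, p (shiftLabel ε c x) = p x) →
      ∑ x, t (fun i => x i) * p x = z * ∑ x, p x := by
  classical
  let T : ℂ := ∑ c : C, t fun i => ε.symm ((c : ι → F) i)
  have hT : ∀ x : ι → A, ∑ c : C, t (fun i => shiftLabel ε (c : ι → F) x i) = T := by
    intro x
    -- On `S` the label `x` looks like a codeword `c₀`, so shifting by `x` only reindexes the sum
    -- over `C`.
    obtain ⟨c₀, hc₀, h⟩ := hS (ε ∘ x)
    refine Fintype.sum_equiv (Equiv.addLeft (⟨c₀, hc₀⟩ : C)) _ _ fun c => ?_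
    congr 1
    ext i
    simp [shiftLabel_apply, h i i.2]
  have hcard : (Fintype.card C : ℂ) ≠ 0 := by simp
  refine ⟨T / Fintype.card C, fun p hp => ?_⟩
  have h : (Fintype.card C : ℂ) * ∑ x, t (fun i => x i) * p x = T * ∑ x, p x := by
    calc (Fintype.card C : ℂ) * ∑ x, t (fun i => x i) * p x
        = ∑ c : C, ∑ x : ι → A, t (fun i => x i) * p x := by simp
      _ = ∑ c : C, ∑ x, t (fun i => shiftLabel ε (c : ι → F) x i) * p x := by
          refine Finset.sum_congr rfl fun c _ => ?_
          rw [← (shiftLabel ε (c : ι → F)).sum_comp]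
          simp only [hp _ c.2]
      _ = T * ∑ x, p x := by
          rw [Finset.sum_comm, Finset.mul_sum]
          simp only [← Finset.sum_mul, hT]
  field_simp
  rw [mul_comm] at h
  rw [← h, mul_comm]

theorem cssCode_detectsError [Fintype F] (ε : A ≃ F) {C D : Submodule F (ι → F)} (hCD : C ≤ D) {S : Finset ι}
    (hC : ∀ f : ι → F, ∃ c ∈ C, ∀ i ∈ S, c i = f i)
    (hD : ∀ x ∈ D, (∀ i, i ∉ S → x i = 0) → x = 0) {E : Matrix (ι → A) (ι → A) ℂ}
    (hE : ActsOnlyOn S E) : DetectsError (cssCode ε C D) E := by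
  obtain ⟨T, hT, hE⟩ := hE
  obtain ⟨z, hz⟩ := sum_local_mul_invariant ε hC fun s => T s s
  refine ⟨z, ?_⟩
  rintro _ ⟨f, rfl⟩ _ ⟨g, rfl⟩
  rw [inner_toEuclideanLin_of_local ε hD hE
    (fun x hx => cosetState_apply_of_notMem _ _ _ _ hx)
    (fun x hx => cosetState_apply_of_notMem _ _ _ _ hx), PiLp.inner_apply,
    ← hz _ fun c hc x => by simp only [cosetState_shiftLabel ε hCD _ hc]]
  refine Finset.sum_congr rfl fun x _ => ?_
  rw [hT x x fun _ _ => rfl]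

/-- The matrix of the translation `|x⟩ ↦ |x + e⟩`. -/
def shiftMatrix (ε : A ≃ F) (e : ι → F) : Matrix (ι → A) (ι → A) ℂ :=
  fun x y => if x = shiftLabel ε e y then 1 else 0

omit [DecidableEq ι] [Fintype A] in
theorem actsOnlyOn_shiftMatrix [DecidableEq F] (ε : A ≃ F) (e : ι → F) :
    ActsOnlyOn (Finset.univ.filter fun i => e i ≠ 0) (shiftMatrix ε e) := by
  refine ⟨fun s t => if ∀ i, s i = ε.symm (ε (t i) + e i) then 1 else 0, fun x y h => ?_,
    fun x y h => ?_⟩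
  · refine if_congr ⟨fun hx i => hx ▸ rfl, fun hx => ?_⟩ rfl rfl
    ext i
    by_cases hi : e i = 0
    · simp [shiftLabel_apply, hi, h i (by simp [hi])]
    · exact hx ⟨i, by simp [hi]⟩
  · refine if_neg fun hx => h fun i hi => ?_
    have : e i = 0 := by simpa using hi
    simp [hx, shiftLabel_apply, this]

theorem toEuclideanLin_shiftMatrix_apply (ε : A ≃ F) (e : ι → F) (v : QuditSpace ι A)
    (x : ι → A) : Matrix.toEuclideanLin (shiftMatrix ε e) v (shiftLabel ε e x) = v x := by
  simp [Matrix.mulVec, dotProduct, shiftMatrix]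

/-- The translation carries the state of the coset of 0 to the orthogonal state of the coset of `e`.
The diagonal matrix element at the first state forces `z = 0`; the one between the two states is
nonzero. -/
theorem cssCode_not_detectsError (ε : A ≃ F) {C D : Submodule F (ι → F)}
    {e : ι → F} (heD : e ∈ D) (heC : e ∉ C) :
    ¬ DetectsError (cssCode ε C D) (shiftMatrix ε e) := by
  classical
  rintro ⟨z, hz⟩
  let q (y : D) : D ⧸ C.comap D.subtype := Submodule.Quotient.mk y
  let s (y : D) : QuditSpace ι A := cosetState ε C D (Pi.single (q y) 1)
  have hs : ∀ y, s y ∈ cssCode ε C D := fun y => ⟨_, rfl⟩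
  have hs0 : ∀ y, inner ℂ (s y) (s y) ≠ 0 := fun y h => by
    have h0 := cosetState_injective ε C D ((inner_self_eq_zero.1 h).trans (map_zero _).symm)
    simpa using congrFun h0 (q y)
  have hshift : Matrix.toEuclideanLin (shiftMatrix ε e) (s 0) = s ⟨e, heD⟩ := by
    ext x
    obtain ⟨x, rfl⟩ := (shiftLabel ε e).surjective x
    rw [toEuclideanLin_shiftMatrix_apply]
    have key : ε ∘ shiftLabel ε e x ∈ D ↔ ε ∘ x ∈ D := by
      rw [comp_shiftLabel]
      exact D.add_mem_iff_left heD
    by_cases h : ε ∘ x ∈ D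
    · simp only [s]
      rw [cosetState_apply_of_mem _ _ _ _ h, cosetState_apply_of_mem _ _ _ _ (key.2 h),
        Pi.single_apply, Pi.single_apply]
      refine if_congr ?_ rfl rfl
      rw [Submodule.Quotient.eq, Submodule.Quotient.eq]
      simp [comp_shiftLabel]
    · simp only [s]
      rw [cosetState_apply_of_notMem _ _ _ _ h, cosetState_apply_of_notMem _ _ _ _ (mt key.1 h)]
  have hq : q ⟨e, heD⟩ ≠ q 0 := fun h => heC <| by
    simpa [q, Submodule.Quotient.mk_eq_zero] using h
  have horth : inner ℂ (s 0) (s ⟨e, heD⟩) = 0 := by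
    rw [PiLp.inner_apply]
    refine Finset.sum_eq_zero fun x _ => ?_
    by_cases h : ε ∘ x ∈ D
    · simp only [s]
      rw [cosetState_apply_of_mem _ _ _ _ h, cosetState_apply_of_mem _ _ _ _ h,
        Pi.single_apply, Pi.single_apply]
      split_ifs with h1 h2
      · exact absurd (h2.symm.trans h1) hq
      all_goals simp
    · simp only [s]
      rw [cosetState_apply_of_notMem _ _ _ _ h]
      simp
  have h1 := hz _ (hs 0) _ (hs 0)
  rw [hshift, horth, eq_comm, mul_eq_zero, or_iff_left (hs0 0)] at h1
  have h2 := hz _ (hs ⟨e, heD⟩) _ (hs 0)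
  rw [hshift, h1, zero_mul] at h2
  exact hs0 _ h2

omit [Fintype A] [DecidableEq A] [DecidableEq ι] [Fintype ι] in
/-- A self-orthogonal code of dimension `k` whose dual has minimum distance `d`, attained outside
the code, gives a quantum code `[[n, n - 2k, d]]`. -/
theorem exists_isQuantumCode_of_le_dualCode [Fintype F] [DecidableEq F] {n k d q : ℕ}
    (hq : Fintype.card F = q) {C : Submodule F (Fin n → F)} (hk : Module.finrank F C = k)
    (hC : C ≤ dualCode C) (hd : ∀ x ∈ dualCode C, x ≠ 0 → d ≤ hammingNorm x)
    {e : Fin n → F} (he : e ∈ dualCode C) (heC : e ∉ C) (hed : hammingNorm e = d) :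
    ∃ Q : Submodule ℂ (QuditSpace (Fin n) (Fin q)), IsQuantumCode n (n - 2 * k) d q Q := by
  let ε : Fin q ≃ F := (Fintype.equivFinOfCardEq hq).symm
  refine ⟨cssCode ε C (dualCode C), ?_, ⟨_, hed, _, actsOnlyOn_shiftMatrix ε e,
    cssCode_not_detectsError ε he heC⟩, ?_⟩
  · rw [finrank_cssCode ε hC, hq, hk]
    have := finrank_add_finrank_dualCode C
    rw [hk, Fintype.card_fin] at this
    congr 1
    omega
  · rintro _ ⟨S, rfl, E, hE, hnot⟩
    by_contra! hS
    refine hnot (cssCode_detectsError ε hC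
      (exists_mem_eq_on_of_card_lt_dual_distance hd hS) (fun x hx hxS => ?_) hE)
    by_contra hx0
    refine absurd ((hd x hx hx0).trans (Finset.card_le_card fun i hi => ?_)) hS.not_ge
    by_contra hiS
    exact (Finset.mem_filter.1 hi).2 (hxS i hiS)

end CSS

/-! ### The product code and its dual -/

section ProductCode

variable {F ι : Type*} [Field F]

theorem eq_zero_of_card_le_of_sum_mul_pow_eq_zero {m : ℕ} (a : Fin m → F) (s : Finset F)
    (hs : m ≤ s.card) (h : ∀ x ∈ s, ∑ j, a j * x ^ (j : ℕ) = 0) : a = 0 := by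
  have hp : wordPolynomial a = 0 := by
    refine Polynomial.eq_zero_of_degree_lt_of_eval_finset_eq_zero s
      ((Polynomial.degree_sum_fin_lt a).trans_le (by exact_mod_cast hs)) fun x hx => ?_
    simpa [wordPolynomial, Polynomial.eval_finsetSum] using h x hx
  ext j
  have := congrArg (Polynomial.coeff · (j : ℕ)) hp
  simpa [wordPolynomial, Polynomial.finsetSum_coeff, Polynomial.coeff_X_pow, Fin.val_inj]
    using this

theorem eval_eq_sum_fin {f : Polynomial F} {m : ℕ} (hf : f.degree < m) (x : F) :
    f.eval x = ∑ j : Fin m, f.coeff j * x ^ (j : ℕ) := by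
  rw [Fin.sum_univ_eq_sum_range fun j => f.coeff j * x ^ j]
  rcases eq_or_ne f 0 with rfl | hf0
  · simp
  · exact Polynomial.eval_eq_sum_range' ((Polynomial.natDegree_lt_iff_degree_lt hf0).2 hf) x

/-- The word of values of the monomial `x ^ (j + 1) * y ^ k` at the points of `Fˣ × Fˣ`. -/
def monomialWord (σ : ι ≃ Fˣ × Fˣ) {μ₁ μ₂ : ℕ} (p : Fin μ₁ × Fin μ₂) (i : ι) : F :=
  ((σ i).1 : F) ^ ((p.1 : ℕ) + 1) * ((σ i).2 : F) ^ (p.2 : ℕ)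

/-- The product of two Reed-Solomon codes of dimensions `μ₁` and `μ₂`: the evaluation code of the
polynomials `x * f x y`, with `f` of degree less than `μ₁` in `x` and less than `μ₂` in `y`. -/
def productCode (σ : ι ≃ Fˣ × Fˣ) (μ₁ μ₂ : ℕ) : Submodule F (ι → F) :=
  Submodule.span F (Set.range (monomialWord σ (μ₁ := μ₁) (μ₂ := μ₂)))

theorem sum_smul_monomialWord_apply (σ : ι ≃ Fˣ × Fˣ) {μ₁ μ₂ : ℕ} (a : Fin μ₁ × Fin μ₂ → F)
    (i : ι) : (∑ p, a p • monomialWord σ p) i =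
      (σ i).1 * ∑ j, (∑ k, a (j, k) * ((σ i).2 : F) ^ (k : ℕ)) * ((σ i).1 : F) ^ (j : ℕ) := by
  simp only [Finset.sum_apply, Pi.smul_apply, smul_eq_mul, monomialWord,
    Fintype.sum_prod_type, Finset.mul_sum, Finset.sum_mul]
  refine Finset.sum_congr rfl fun j _ => Finset.sum_congr rfl fun k _ => ?_
  ring

theorem polynomial_word_mem_productCode (σ : ι ≃ Fˣ × Fˣ) {μ₁ μ₂ : ℕ} {f g : Polynomial F}
    (hf : f.degree < μ₁) (hg : g.degree < μ₂) :
    (fun i => ((σ i).1 : F) * f.eval ((σ i).1 : F) * g.eval ((σ i).2 : F)) ∈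
      productCode σ μ₁ μ₂ := by
  refine (Submodule.mem_span_range_iff_exists_fun F).2
    ⟨fun p => f.coeff p.1 * g.coeff p.2, ?_⟩
  ext i
  rw [sum_smul_monomialWord_apply, eval_eq_sum_fin hf, eval_eq_sum_fin hg, mul_assoc,
    Finset.sum_mul]
  congr 1
  refine Finset.sum_congr rfl fun j _ => ?_
  rw [Finset.mul_sum, Finset.sum_mul]
  refine Finset.sum_congr rfl fun k _ => ?_
  ring

theorem mem_dualCode_productCode [Fintype ι] [DecidableEq ι]
    {σ : ι ≃ Fˣ × Fˣ} {μ₁ μ₂ : ℕ} {x : ι → F} :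
    x ∈ dualCode (productCode σ μ₁ μ₂) ↔
      ∀ p : Fin μ₁ × Fin μ₂, monomialWord σ p ⬝ᵥ x = 0 := by
  rw [mem_dualCode]
  refine ⟨fun h p => h _ (Submodule.subset_span ⟨p, rfl⟩), fun h c hc => ?_⟩
  obtain ⟨a, rfl⟩ := (Submodule.mem_span_range_iff_exists_fun F).1 hc
  simp [sum_dotProduct, h]

theorem card_image_units [DecidableEq F] (s : Finset Fˣ) :
    (s.image (fun u : Fˣ => (u : F))).card = s.card :=
  Finset.card_image_of_injective _ Units.val_injective

/-- The monomials are independent as functions: for fixed y a vanishing combination is a polynomial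
in x with too many roots, and its coefficients are then polynomials in y with too many roots. -/
theorem finrank_productCode [Fintype F] [DecidableEq F]
    (σ : ι ≃ Fˣ × Fˣ) {μ₁ μ₂ : ℕ} (h₁ : μ₁ ≤ Fintype.card Fˣ)
    (h₂ : μ₂ ≤ Fintype.card Fˣ) : Module.finrank F (productCode σ μ₁ μ₂) = μ₁ * μ₂ := by
  have h : LinearIndependent F (monomialWord σ (μ₁ := μ₁) (μ₂ := μ₂)) := by
    rw [Fintype.linearIndependent_iff]
    intro a ha
    have hb : ∀ (y : Fˣ), (fun j => ∑ k, a (j, k) * (y : F) ^ (k : ℕ)) = 0 := fun y => by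
      refine eq_zero_of_card_le_of_sum_mul_pow_eq_zero _
        (Finset.univ.image fun u : Fˣ => (u : F)) (by rwa [card_image_units]) ?_
      simp only [Finset.mem_image, Finset.mem_univ, true_and, forall_exists_index,
        forall_apply_eq_imp_iff]
      intro x
      have := congrFun ha (σ.symm (x, y))
      rw [sum_smul_monomialWord_apply] at this
      simpa using this
    rintro ⟨j, k⟩
    refine congrFun (eq_zero_of_card_le_of_sum_mul_pow_eq_zero (fun k => a (j, k))
      (Finset.univ.image fun u : Fˣ => (u : F)) (by rwa [card_image_units]) ?_) k
    simp only [Finset.mem_image, Finset.mem_univ, true_and, forall_exists_index,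
      forall_apply_eq_imp_iff]
    exact fun y => congrFun (hb y) j
  rw [productCode, finrank_span_eq_card h]
  simp

theorem productCode_le_dualCode [Fintype F] [DecidableEq F] [Fintype ι] [DecidableEq ι]
    (σ : ι ≃ Fˣ × Fˣ) {μ₁ : ℕ} (μ₂ : ℕ)
    (h₁ : 2 * μ₁ < Fintype.card Fˣ) :
    productCode σ μ₁ μ₂ ≤ dualCode (productCode σ μ₁ μ₂) := by
  refine Submodule.span_le.2 ?_
  rintro _ ⟨⟨j', k'⟩, rfl⟩
  refine mem_dualCode_productCode.2 fun ⟨j, k⟩ => ?_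
  -- The shift by 1 in each exponent excludes exponent 0, where the sum would be -1.
  have hsum : ∑ x : Fˣ, (x : F) ^ ((j : ℕ) + 1 + (j' + 1)) = 0 := by
    rw [FiniteField.sum_pow_units, if_neg]
    rw [← Fintype.card_units]
    exact Nat.not_dvd_of_pos_of_lt (by omega) (by omega)
  calc monomialWord σ (j, k) ⬝ᵥ monomialWord σ (j', k')
      = ∑ z : Fˣ × Fˣ, (z.1 : F) ^ ((j : ℕ) + 1 + (j' + 1)) * (z.2 : F) ^ ((k : ℕ) + k') := by
        rw [← σ.sum_comp]
        refine Finset.sum_congr rfl fun i _ => ?_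
        simp only [monomialWord]
        ring
    _ = 0 := by
        rw [Fintype.sum_prod_type]
        simp only [← Finset.mul_sum, ← Finset.sum_mul, hsum, zero_mul]

/-- Nonzero words of the product code are not of low weight. -/
theorem card_lt_hammingNorm_add_of_mem_productCode [Fintype F] [DecidableEq F] [Fintype ι]
    {σ : ι ≃ Fˣ × Fˣ} {μ₁ μ₂ : ℕ} {c : ι → F}
    (hc : c ∈ productCode σ μ₁ μ₂) (hc0 : c ≠ 0) :
    Fintype.card Fˣ < hammingNorm c + μ₁ := by
  obtain ⟨a, rfl⟩ := (Submodule.mem_span_range_iff_exists_fun F).1 hc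
  set c := ∑ p, a p • monomialWord σ p with hcdef
  obtain ⟨i, hi⟩ := Function.ne_iff.1 hc0
  -- On the line through a nonzero coordinate with `y` fixed, the word is x times a nonzero
  -- polynomial of degree less than `μ₁`.
  set y := (σ i).2 with hy
  have hz : (Finset.univ.filter fun x : Fˣ => c (σ.symm (x, y)) = 0).card < μ₁ := by
    by_contra! hle
    apply hi
    have := eq_zero_of_card_le_of_sum_mul_pow_eq_zero
      (fun j => ∑ k, a (j, k) * (y : F) ^ (k : ℕ)) _ (hle.trans_eq (card_image_units _).symm) (by
        simp only [Finset.mem_image, Finset.mem_filter, Finset.mem_univ, true_and,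
          forall_exists_index, and_imp]
        rintro _ x hx rfl
        rw [hcdef, sum_smul_monomialWord_apply] at hx
        simpa using hx)
    rw [hcdef, sum_smul_monomialWord_apply, ← hy]
    simp only [fun j => congrFun this j, Pi.zero_apply, zero_mul, Finset.sum_const_zero, mul_zero]
  have hn : (Finset.univ.filter fun x : Fˣ => ¬ c (σ.symm (x, y)) = 0).card ≤ hammingNorm c := by
    refine Finset.card_le_card_of_injOn (fun x => σ.symm (x, y)) (fun x hx => ?_) fun x _ x' _ h => ?_
    · simpa using hx
    · simpa using h
  have := Finset.card_filter_add_card_filter_not (s := (Finset.univ : Finset Fˣ))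
    fun x : Fˣ => c (σ.symm (x, y)) = 0
  rw [Finset.card_univ] at this
  omega

/-- For points `s` and a further point `a`, there is a polynomial of degree less than `m` killing
all points of `s` but `a`, if `s` has at most `m` points. -/
theorem exists_polynomial_separating [DecidableEq F]
    {s : Finset F} {a : F} (ha : a ∈ s) {m : ℕ} (hs : s.card ≤ m) :
    ∃ f : Polynomial F, f.degree < m ∧ f.eval a ≠ 0 ∧ ∀ x ∈ s, x ≠ a → f.eval x = 0 := by
  refine ⟨∏ x ∈ s.erase a, (Polynomial.X - Polynomial.C x), ?_, ?_, fun x hx hxa => ?_⟩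
  · rw [Polynomial.degree_prod]
    simp only [Polynomial.degree_X_sub_C, Finset.sum_const, Finset.card_erase_of_mem ha, nsmul_one]
    have := Finset.card_pos.2 ⟨a, ha⟩
    norm_cast
    omega
  · rw [Polynomial.eval_prod, Finset.prod_ne_zero_iff]
    intro x hx
    simpa [sub_eq_zero] using (Finset.ne_of_mem_erase hx).symm
  · rw [Polynomial.eval_prod]
    exact Finset.prod_eq_zero (Finset.mem_erase.2 ⟨hxa, hx⟩) (by simp)

/-- If the support has at most min(μ₁, μ₂) points, so do its two projections; a product f(x) g(y)
then isolates one support point, and x f(x) g(y) is not orthogonal to the word. -/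
theorem le_hammingNorm_of_mem_dualCode_productCode [DecidableEq F] [Fintype ι] [DecidableEq ι]
    {σ : ι ≃ Fˣ × Fˣ} {μ₁ μ₂ : ℕ} {w : ι → F}
    (hw : w ∈ dualCode (productCode σ μ₁ μ₂)) (hw0 : w ≠ 0) :
    1 + min μ₁ μ₂ ≤ hammingNorm w := by
  by_contra! hlt
  obtain ⟨i₀, hi₀⟩ := Function.ne_iff.1 hw0
  set s := Finset.univ.filter fun i => w i ≠ 0 with hs
  have hs' : hammingNorm w = s.card := rfl
  have hmem : i₀ ∈ s := by simpa [hs] using hi₀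
  obtain ⟨f, hf, hf0, hfs⟩ := exists_polynomial_separating
    (Finset.mem_image_of_mem (fun i => ((σ i).1 : F)) hmem) (m := μ₁)
    (Finset.card_image_le.trans (by omega))
  obtain ⟨g, hg, hg0, hgs⟩ := exists_polynomial_separating
    (Finset.mem_image_of_mem (fun i => ((σ i).2 : F)) hmem) (m := μ₂)
    (Finset.card_image_le.trans (by omega))
  have h := mem_dualCode.1 hw _ (polynomial_word_mem_productCode σ hf hg)
  rw [dotProduct, Finset.sum_eq_single i₀ (fun i _ hi => ?_) (by simp)] at h
  · simp_all
  · by_cases his : i ∈ s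
    · by_cases h1 : (σ i).1 = (σ i₀).1
      · have h2 : ((σ i).2 : F) ≠ (σ i₀).2 := fun h2 =>
          hi (σ.injective (Prod.ext h1 (Units.ext h2)))
        simp only [hgs _ (Finset.mem_image_of_mem _ his) h2, mul_zero, zero_mul]
      · have h1 : ((σ i).1 : F) ≠ (σ i₀).1 := fun h => h1 (Units.ext h)
        simp only [hfs _ (Finset.mem_image_of_mem _ his) h1, mul_zero, zero_mul]
    · have : w i = 0 := by simpa [hs] using his
      simp [this]

/-- Fewer linear conditions than coordinates in `s` leave a nonzero word supported on `s`. -/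
theorem exists_ne_zero_supported_dotProduct_eq_zero [Fintype ι]
    {m : ℕ} (g : Fin m → ι → F) {s : Finset ι}
    (hs : m < s.card) :
    ∃ w : ι → F, w ≠ 0 ∧ (∀ i, i ∉ s → w i = 0) ∧ ∀ j, g j ⬝ᵥ w = 0 := by
  let E : (s → F) →ₗ[F] (ι → F) := Function.ExtendByZero.linearMap F Subtype.val
  obtain ⟨v, hv, hv0⟩ := Submodule.exists_mem_ne_zero_of_ne_bot
    (LinearMap.ker_ne_bot_of_finrank_lt (f := (Matrix.mulVecLin (Matrix.of g)) ∘ₗ E) (by simpa))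
  have hE : ∀ i : s, E v i = v i := fun i => Subtype.val_injective.extend_apply _ _ _
  refine ⟨E v, fun h => hv0 ?_, fun i hi => ?_, fun j => congrFun (LinearMap.mem_ker.1 hv) j⟩
  · ext i
    rw [← hE, h]
    rfl
  · exact Function.extend_apply' _ _ _ fun ⟨a, ha⟩ => hi (ha ▸ a.2)

/-- On a line y = 1 or x = 1 the monomials reduce to μ₁ or μ₂ functions respectively. Choosing the
smaller number, 1 + min(μ₁, μ₂) points of the line outnumber the conditions. -/
theorem exists_mem_dualCode_productCode_hammingNorm_le [Fintype F] [DecidableEq F] [Fintype ι] [DecidableEq ι]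
    (σ : ι ≃ Fˣ × Fˣ) {μ₁ μ₂ : ℕ}
    (h : min μ₁ μ₂ < Fintype.card Fˣ) :
    ∃ w ∈ dualCode (productCode σ μ₁ μ₂), w ≠ 0 ∧ hammingNorm w ≤ 1 + min μ₁ μ₂ := by
  obtain ⟨t, -, ht⟩ := Finset.exists_subset_card_eq (s := (Finset.univ : Finset Fˣ))
    (n := 1 + min μ₁ μ₂) (by rw [Finset.card_univ]; omega)
  have key : ∀ (φ : Fˣ → Fˣ × Fˣ), Function.Injective φ → ∀ g : Fin (min μ₁ μ₂) → ι → F,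
      (∀ p : Fin μ₁ × Fin μ₂, ∃ j, ∀ x, monomialWord σ p (σ.symm (φ x)) = g j (σ.symm (φ x))) →
      ∃ w ∈ dualCode (productCode σ μ₁ μ₂), w ≠ 0 ∧ hammingNorm w ≤ 1 + min μ₁ μ₂ := by
    intro φ hφ g hg
    have hcard : (t.image fun x => σ.symm (φ x)).card = 1 + min μ₁ μ₂ := by
      rw [← ht]
      exact Finset.card_image_of_injective _ (σ.symm.injective.comp hφ)
    obtain ⟨w, hw0, hws, hw⟩ := exists_ne_zero_supported_dotProduct_eq_zero g
      (s := t.image fun x => σ.symm (φ x)) (by omega)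
    refine ⟨w, mem_dualCode_productCode.2 fun p => ?_, hw0, ?_⟩
    · obtain ⟨j, hj⟩ := hg p
      rw [← hw j]
      refine Finset.sum_congr rfl fun i _ => ?_
      by_cases hi : i ∈ t.image fun x => σ.symm (φ x)
      · obtain ⟨x, -, rfl⟩ := Finset.mem_image.1 hi
        rw [hj]
      · rw [hws i hi, mul_zero, mul_zero]
    · refine (Finset.card_le_card fun i hi => ?_).trans_eq hcard
      by_contra hi'
      exact (Finset.mem_filter.1 hi).2 (hws i hi')
  rcases le_total μ₁ μ₂ with hle | hle
  · refine key (fun x => (x, 1)) (fun x y h => by simpa using h)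
      (fun j i => ((σ i).1 : F) ^ ((j : ℕ) + 1)) fun p =>
        ⟨⟨p.1, by omega⟩, fun x => by simp [monomialWord]⟩
  · refine key (fun x => (1, x)) (fun x y h => by simpa using h)
      (fun j i => ((σ i).2 : F) ^ (j : ℕ)) fun p =>
        ⟨⟨p.2, by omega⟩, fun x => by simp [monomialWord]⟩

end ProductCode

/-! ### Assembly of the quantum code -/

theorem mainTheorem1 {F : Type*} [Field F] [Fintype F] [DecidableEq F] (q : ℕ)
    (hq : Fintype.card F = q) (μ₁ μ₂ : ℕ)
    (C₁ C₂ : Submodule F (Fin (q - 1) → F))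
    (hC₁ : IsReedSolomon q C₁) (hC₁' : HasCodeParameters C₁ μ₁ (q - μ₁))
    (hC₂ : IsReedSolomon q C₂) (hC₂' : HasCodeParameters C₂ μ₂ (q - μ₂))
    (hμ₁ : (μ₁ : ℝ) < ((q : ℝ) - 1) / 2) :
    2 * μ₁ * μ₂ < (q - 1) ^ 2 ∧
      ∃ Q : Submodule ℂ (QuditSpace (Fin ((q - 1) ^ 2)) (Fin q)),
        IsQuantumCode ((q - 1) ^ 2) ((q - 1) ^ 2 - 2 * μ₁ * μ₂) (1 + min μ₁ μ₂) q Q := by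
  have hn : Fintype.card Fˣ = q - 1 := by rw [Fintype.card_units, hq]
  have h₁ : 2 * μ₁ < q - 1 := by
    have : ((2 * μ₁ + 1 : ℕ) : ℝ) < q := by push_cast; linarith
    have := Nat.cast_lt.1 this
    omega
  have h₂ : μ₂ ≤ q - 1 := by
    have := Submodule.finrank_le C₂
    rwa [hC₂'.1, Module.finrank_fin_fun] at this
  refine ⟨by nlinarith, ?_⟩
  let σ : Fin ((q - 1) ^ 2) ≃ Fˣ × Fˣ :=
    (Fintype.equivFinOfCardEq (by rw [Fintype.card_prod, hn, sq])).symm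
  obtain ⟨e, he, he0, hle⟩ := exists_mem_dualCode_productCode_hammingNorm_le σ
    (μ₁ := μ₁) (μ₂ := μ₂) (by omega)
  rw [mul_assoc]
  refine exists_isQuantumCode_of_le_dualCode hq
    (finrank_productCode σ (by omega) (by omega)) (productCode_le_dualCode σ μ₂ (by omega))
    (fun x hx hx0 => le_hammingNorm_of_mem_dualCode_productCode hx hx0) he (fun heC => ?_)
    (hle.antisymm (le_hammingNorm_of_mem_dualCode_productCode he he0))
  -- Membership would force weight above q - 1 - μ₁ ≥ μ₁ + 1, but `e` has weight at most 1 + min(μ₁,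
  -- μ₂).
  have := card_lt_hammingNorm_add_of_mem_productCode heC he0
  omega
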